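/- All graphs are finite and simple. A fractional coloring of a graph $G$ assigns a nonnegative real weight to each independent set of $G$ so that, for every vertex $v$, the weights of the independent sets containing $v$ sum to at least $1$; a fractional cocoloring does the same with the vertex sets that are cliques or independent sets. The fractional chromatic number $\chi_f(G)$ (respectively, the fractional cochromatic number $Z_f(G)$) is the minimum total weight of a fractional coloring (respectively, a fractional cocoloring) of $G$. **Theorem.** There is a function $\varepsilon:\mathbb R\to\mathbb R$ with $\varepsilon(m)\to 0$ as $m\to\infty$ such that every graph $G$ with $\chi_f(G)=m>1$ has a (not necessarily induced) subgraph $H$ with $$Z_f(H)\ \ge\ \Bigl(\tfrac14-\varepsilon(m)\Bigr)\frac{m}{\log_2 m}.$$ Furthermore, this is tight up to a constant factor for complete graphs: $\chi_f(K_n)=n$ for every integer $n\ge 0$, and there is a constant $C>0$ such that for every integer $n\ge 2$ every subgraph $H$ of $K_n$ satisfies $$Z_f(H)\ \le\ C\,\frac{n}{\log_2 n}.$$ -/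

import Mathlib

open Filter Topology

/-- `w` is a fractional coloring of the finite graph `G`: a nonnegative real weight on the
independent sets of `G` (encoded as a function on all vertex sets that vanishes on the others)
such that, for every vertex `v`, the weights of the independent sets containing `v` sum to at
least one.  All sums range over the finite type `Set V`. -/
structure SimpleGraph.IsFractionalColoring {V : Type*} [Finite V] (G : SimpleGraph V)
    (w : Set V → ℝ) : Prop where
  nonneg : ∀ s, 0 ≤ w s
  support : ∀ s, w s ≠ 0 → G.IsIndepSet s
  cover : ∀ v, 1 ≤ ∑ᶠ (s : Set V) (_ : v ∈ s), w s

/-- `w` is a fractional cocoloring of the finite graph `G`: a nonnegative real weight on the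
cliques and independent sets of `G` (vanishing on all other vertex sets) such that, for every
vertex `v`, the weights of the cliques and independent sets containing `v` sum to at least one. -/
structure SimpleGraph.IsFractionalCocoloring {V : Type*} [Finite V] (G : SimpleGraph V)
    (w : Set V → ℝ) : Prop where
  nonneg : ∀ s, 0 ≤ w s
  support : ∀ s, w s ≠ 0 → G.IsClique s ∨ G.IsIndepSet s
  cover : ∀ v, 1 ≤ ∑ᶠ (s : Set V) (_ : v ∈ s), w s

/-- The fractional chromatic number of a finite graph: the least total weight of a fractional
coloring. -/
noncomputable def SimpleGraph.fractionalChromaticNumber {V : Type*} [Finite V]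
    (G : SimpleGraph V) : ℝ :=
  sInf {x : ℝ | ∃ w : Set V → ℝ, G.IsFractionalColoring w ∧ ∑ᶠ s : Set V, w s = x}

/-- The fractional cochromatic number of a finite graph: the least total weight of a fractional
cocoloring. -/
noncomputable def SimpleGraph.fractionalCochromaticNumber {V : Type*} [Finite V]
    (G : SimpleGraph V) : ℝ :=
  sInf {x : ℝ | ∃ w : Set V → ℝ, G.IsFractionalCocoloring w ∧ ∑ᶠ s : Set V, w s = x}

/-! Lower bound. LP duality gives a weight `f` on the vertices of total nearly `m` under which every
independent set of `G` weighs at most 1. It suffices to find `H ≤ G` in which every clique and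
independent set weighs at most `B = 4 log₂ m + 6`, because `f / B` is then dual feasible for
cocolorings of `H`.

Keep each edge of `G` with probability 1/2. A set homogeneous in `H` has all of its `G`-edges kept
or all dropped, so one spanning many `G`-edges is unlikely to be homogeneous. The number of vertices
is not bounded in terms of `m`, so the union bound runs over initial segments of an order along
which `f` decreases, with an allowance growing with the segment (`exists_le_card_edgePairs_le`).
Integrating over the level sets of `f` makes that allowance a constant (`sum_edgePairs_le`): a
homogeneous `S` of weight `t` has `∑ f p.2 ≤ t L + L + 6` over its `G`-edges, where `L = log₂ m`.
Conversely, greedy colouring makes this sum at least about `t² / 4` (`mul_sub_le_sum_edgePairs`), so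
`t ≤ 4 L + 6`.

Tightness. By Ramsey, any graph on at most `n` vertices is covered by `O(n / log n)` homogeneous
sets, obtained by removing sets of size about `(log₂ n) / 4` until about `√n` vertices remain. -/

namespace SimpleGraph

variable {V : Type*}

/-! ### Fractional covers and weak duality -/

open Classical in
theorem finsum_mem_eq_sum_ite [Fintype V] (w : Set V → ℝ) (v : V) :
    ∑ᶠ (s : Set V) (_ : v ∈ s), w s = ∑ s : Set V, if v ∈ s then w s else 0 := by
  rw [finsum_eq_sum_of_fintype]
  exact Finset.sum_congr rfl fun s _ => finsum_eq_if

/-- Weak duality for covering the vertices by weighted sets. -/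
theorem sum_le_finsum_of_cover [Fintype V] {w : Set V → ℝ} {g : V → ℝ} (hg : ∀ v, 0 ≤ g v)
    (hw : ∀ s, 0 ≤ w s) (hcover : ∀ v, 1 ≤ ∑ᶠ (s : Set V) (_ : v ∈ s), w s)
    (hs : ∀ s, w s ≠ 0 → ∑ v, s.indicator g v ≤ 1) : ∑ v, g v ≤ ∑ᶠ s, w s := by
  classical
  rw [finsum_eq_sum_of_fintype]
  calc ∑ v, g v ≤ ∑ v, g v * ∑ s : Set V, (if v ∈ s then w s else 0) := by
        refine Finset.sum_le_sum fun v _ => le_mul_of_one_le_right (hg v) ?_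
        rw [← finsum_mem_eq_sum_ite]
        exact hcover v
    _ = ∑ s : Set V, w s * ∑ v, s.indicator g v := by
        simp_rw [Finset.mul_sum]
        rw [Finset.sum_comm]
        refine Finset.sum_congr rfl fun s _ => Finset.sum_congr rfl fun v _ => ?_
        by_cases h : v ∈ s <;> simp [h, mul_comm]
    _ ≤ ∑ s : Set V, w s := by
        refine Finset.sum_le_sum fun s _ => ?_
        by_cases h : w s = 0
        · simp [h]
        · exact mul_le_of_le_one_right (hw s) (hs s h)

/-- A finite family of sets covering the vertices, as a weight function. -/
theorem indicator_cover [Finite V] (P : Finset (Set V)) (hcov : ∀ v, ∃ s ∈ P, v ∈ s) (v : V) :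
    1 ≤ ∑ᶠ (s : Set V) (_ : v ∈ s), (P : Set (Set V)).indicator (fun _ => (1 : ℝ)) s := by
  classical
  have := Fintype.ofFinite V
  rw [finsum_mem_eq_sum_ite]
  obtain ⟨s, hs, hv⟩ := hcov v
  refine le_trans ?_ (Finset.single_le_sum (f := fun s => if v ∈ s then
    (P : Set (Set V)).indicator (fun _ => (1 : ℝ)) s else 0) (fun t _ => ?_) (Finset.mem_univ s))
  · simp [hv, hs]
  · split_ifs
    · exact Set.indicator_nonneg (fun _ _ => zero_le_one) _
    · exact le_rfl

theorem finsum_indicator_eq_card [Finite V] (P : Finset (Set V)) :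
    ∑ᶠ s, (P : Set (Set V)).indicator (fun _ => (1 : ℝ)) s = P.card := by
  classical
  have := Fintype.ofFinite V
  rw [finsum_eq_sum_of_fintype, Finset.sum_indicator_eq_sum_filter]
  simp

theorem isFractionalColoring_indicator [Finite V] (G : SimpleGraph V) (P : Finset (Set V))
    (hP : ∀ s ∈ P, G.IsIndepSet s) (hcov : ∀ v, ∃ s ∈ P, v ∈ s) :
    G.IsFractionalColoring ((P : Set (Set V)).indicator fun _ => 1) where
  nonneg s := Set.indicator_nonneg (fun _ _ => zero_le_one) _
  support s hs := hP s (by simpa using Set.mem_of_indicator_ne_zero hs)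
  cover := indicator_cover P hcov

theorem isFractionalCocoloring_indicator [Finite V] (G : SimpleGraph V) (P : Finset (Set V))
    (hP : ∀ s ∈ P, G.IsClique s ∨ G.IsIndepSet s) (hcov : ∀ v, ∃ s ∈ P, v ∈ s) :
    G.IsFractionalCocoloring ((P : Set (Set V)).indicator fun _ => 1) where
  nonneg s := Set.indicator_nonneg (fun _ _ => zero_le_one) _
  support s hs := hP s (by simpa using Set.mem_of_indicator_ne_zero hs)
  cover := indicator_cover P hcov

theorem fractionalChromaticNumber_le [Finite V] {G : SimpleGraph V} {w : Set V → ℝ}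
    (hw : G.IsFractionalColoring w) : G.fractionalChromaticNumber ≤ ∑ᶠ s, w s :=
  csInf_le ⟨0, by rintro _ ⟨w, hw, rfl⟩; exact finsum_nonneg hw.nonneg⟩ ⟨w, hw, rfl⟩

theorem fractionalCochromaticNumber_le_card [Finite V] (G : SimpleGraph V) (P : Finset (Set V))
    (hP : ∀ s ∈ P, G.IsClique s ∨ G.IsIndepSet s) (hcov : ∀ v, ∃ s ∈ P, v ∈ s) :
    G.fractionalCochromaticNumber ≤ P.card :=
  csInf_le ⟨0, by rintro _ ⟨w, hw, rfl⟩; exact finsum_nonneg hw.nonneg⟩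
    ⟨_, isFractionalCocoloring_indicator G P hP hcov, finsum_indicator_eq_card P⟩

theorem exists_singletons_cover (V : Type*) [Fintype V] : ∃ P : Finset (Set V),
    P.card ≤ Fintype.card V ∧ (∀ s ∈ P, s.Subsingleton) ∧ ∀ v, ∃ s ∈ P, v ∈ s := by
  classical
  refine ⟨Finset.univ.image fun v => {v}, Finset.card_image_le, ?_, fun v => ⟨{v}, ?_⟩⟩
  · simp
  · simp

theorem le_fractionalChromaticNumber [Fintype V] {G : SimpleGraph V} {g : V → ℝ}
    (hg : ∀ v, 0 ≤ g v) (hs : ∀ s, G.IsIndepSet s → ∑ v, s.indicator g v ≤ 1) :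
    ∑ v, g v ≤ G.fractionalChromaticNumber := by
  obtain ⟨P, -, hP, hcov⟩ := exists_singletons_cover V
  refine le_csInf ⟨_, _, G.isFractionalColoring_indicator P
    (fun s hs => (hP s hs).pairwise _) hcov, rfl⟩ ?_
  rintro _ ⟨w, hw, rfl⟩
  exact sum_le_finsum_of_cover hg hw.nonneg hw.cover fun s h => hs s (hw.support s h)

theorem le_fractionalCochromaticNumber [Fintype V] {G : SimpleGraph V} {g : V → ℝ}
    (hg : ∀ v, 0 ≤ g v)
    (hs : ∀ s, G.IsClique s ∨ G.IsIndepSet s → ∑ v, s.indicator g v ≤ 1) :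
    ∑ v, g v ≤ G.fractionalCochromaticNumber := by
  obtain ⟨P, -, hP, hcov⟩ := exists_singletons_cover V
  refine le_csInf ⟨_, _, G.isFractionalCocoloring_indicator P
    (fun s hs => Or.inr ((hP s hs).pairwise _)) hcov, rfl⟩ ?_
  rintro _ ⟨w, hw, rfl⟩
  exact sum_le_finsum_of_cover hg hw.nonneg hw.cover fun s h => hs s (hw.support s h)

theorem fractionalChromaticNumber_top (n : ℕ) :
    (⊤ : SimpleGraph (Fin n)).fractionalChromaticNumber = n := by
  refine le_antisymm ?_ ?_
  · obtain ⟨P, hcard, hP, hcov⟩ := exists_singletons_cover (Fin n)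
    refine (fractionalChromaticNumber_le (isFractionalColoring_indicator _ P
      (fun s hs => (hP s hs).pairwise _) hcov)).trans ?_
    rw [finsum_indicator_eq_card]
    simpa using hcard
  · have := le_fractionalChromaticNumber (G := (⊤ : SimpleGraph (Fin n))) (g := fun _ => 1)
      (fun _ => zero_le_one) fun s hs => ?_
    · simpa using this
    · classical
      have hsub : s.Subsingleton := fun a ha b hb => by
        by_contra hne
        exact hs ha hb hne hne
      rw [Finset.sum_indicator_eq_sum_filter]
      simp only [Finset.sum_const, nsmul_eq_mul, mul_one]
      norm_cast
      exact Finset.card_le_one.2 fun a ha b hb => hsub (by simpa using ha) (by simpa using hb)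

/-! ### Strong duality by separation of convex sets -/

/-- Strong duality for the fractional chromatic number, up to an arbitrarily small loss. -/
theorem exists_weight_of_lt_fractionalChromaticNumber [Fintype V] (G : SimpleGraph V) {c : ℝ}
    (hc : 0 < c) (hlt : c < G.fractionalChromaticNumber) :
    ∃ f : V → ℝ, (∀ v, 0 ≤ f v) ∧ ∑ v, f v = c ∧
      ∀ s, G.IsIndepSet s → ∑ v, s.indicator f v ≤ 1 := by
  classical
  let ι := {s : Set V // G.IsIndepSet s}
  let T : (ι → ℝ) →ₗ[ℝ] (V → ℝ) :=
    { toFun := fun w v => ∑ s : ι, if v ∈ s.1 then w s else 0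
      map_add' := fun a b => by
        ext v
        simp only [Pi.add_apply, ← Finset.sum_add_distrib]
        exact Finset.sum_congr rfl fun s _ => by split_ifs <;> simp
      map_smul' := fun a b => by
        ext v
        simp [Finset.mul_sum] }
  have hTcont : Continuous T := T.continuous_of_finiteDimensional
  have hcompact : IsCompact (T '' stdSimplex ℝ ι) := (isCompact_stdSimplex ℝ ι).image hTcont
  have hconv : Convex ℝ (T '' stdSimplex ℝ ι) := (convex_stdSimplex ℝ ι).linear_image T
  -- A probability weight covering every vertex at least `c⁻¹` times would scale by `c` to a
  -- fractional coloring of total weight `c`, below the minimum.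
  have hdisj : Disjoint (T '' stdSimplex ℝ ι) (Set.Ici fun _ => c⁻¹) := by
    rw [Set.disjoint_left]
    rintro _ ⟨w, ⟨hw0, hw1⟩, rfl⟩ hle
    refine absurd hlt (not_lt.2 ?_)
    let w' : Set V → ℝ := fun s => if h : G.IsIndepSet s then c * w ⟨s, h⟩ else 0
    have hsum : ∀ p : Set V → Prop, ∑ s : Set V, (if p s then w' s else 0) =
        c * ∑ s : ι, if p s.1 then w s else 0 := by
      intro p
      have h1 : c * ∑ s : ι, (if p s.1 then w s else 0) =
          ∑ s : ι, if p s.1 then w' s.1 else 0 := by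
        rw [Finset.mul_sum]
        exact Finset.sum_congr rfl fun s _ => by simp [w', s.2]
      rw [h1, ← Finset.sum_subtype (Finset.univ.filter G.IsIndepSet) (by simp)
        (fun s => if p s then w' s else 0)]
      refine (Finset.sum_filter_of_ne fun s _ hs => ?_).symm
      by_contra h
      simp [w', h] at hs
    have hcol : G.IsFractionalColoring w' :=
      { nonneg := fun s => by
          simp only [w']
          split_ifs with h
          · exact mul_nonneg hc.le (hw0 _)
          · exact le_rfl
        support := fun s hs => by
          by_contra h
          simp [w', h] at hs
        cover := fun v => by
          rw [finsum_mem_eq_sum_ite, hsum]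
          have h1 : c⁻¹ ≤ T w v := hle v
          calc (1 : ℝ) = c * c⁻¹ := (mul_inv_cancel₀ hc.ne').symm
            _ ≤ _ := mul_le_mul_of_nonneg_left h1 hc.le }
    refine (fractionalChromaticNumber_le hcol).trans_eq ?_
    have := hsum fun _ => True
    simp only [if_true] at this
    rw [finsum_eq_sum_of_fintype, this, hw1, mul_one]
  obtain ⟨φ, u, v, hφu, huv, hvφ⟩ := geometric_hahn_banach_compact_closed hconv hcompact
    (convex_Ici _) isClosed_Ici hdisj
  let g : V → ℝ := fun x => φ (Pi.single x 1)
  have hφ : ∀ y : V → ℝ, φ y = ∑ x, y x * g x := fun y => by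
    conv_lhs => rw [pi_eq_sum_univ' y]
    simp [g]
  have hg0 : ∀ x, 0 ≤ g x := by
    intro x
    by_contra! hneg
    have hb : ∀ k : ℝ, 0 ≤ k → v < φ (fun _ => c⁻¹) + k * g x := fun k hk => by
      have := hvφ ((fun _ => c⁻¹) + k • Pi.single x (1 : ℝ)) (by
        rw [Set.mem_Ici]
        refine le_add_of_nonneg_right ?_
        exact smul_nonneg hk (Pi.single_nonneg.2 zero_le_one))
      simpa [g] using this
    have h0 := hb 0 le_rfl
    -- This `k` makes the right side of `hb` exactly `v`: a functional bounded below on an orthant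
    -- has no negative coordinate.
    have := hb ((φ (fun _ => c⁻¹) - v) / (- g x)) (div_nonneg (by linarith) (by linarith))
    rw [div_mul_eq_mul_div, div_neg, mul_div_assoc, div_self hneg.ne] at this
    linarith
  have hind : ∀ s, G.IsIndepSet s → ∑ x, s.indicator g x < u := by
    intro s hs
    have := hφu (T (Pi.single ⟨s, hs⟩ 1)) ⟨_, single_mem_stdSimplex ℝ _, rfl⟩
    rw [hφ] at this
    convert this using 2 with x
    have hT : T (Pi.single ⟨s, hs⟩ 1) x = if x ∈ s then 1 else 0 := by
      refine (Finset.sum_eq_single (⟨s, hs⟩ : ι) (fun t _ ht => ?_) (by simp)).trans (by simp)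
      simp [Pi.single_eq_of_ne ht]
    by_cases h : x ∈ s <;> simp [hT, h]
  have hu : 0 < u := by simpa using hind ∅ (by simp [IsIndepSet])
  have htot : v < c⁻¹ * ∑ x, g x := by
    have := hvφ (fun _ => c⁻¹) Set.self_mem_Ici
    rwa [hφ, ← Finset.mul_sum] at this
  have hpos : 0 < ∑ x, g x := by
    have : 0 < c⁻¹ * ∑ x, g x := by linarith
    exact pos_of_mul_pos_right this (inv_pos.2 hc).le 
  refine ⟨fun x => c / (∑ x, g x) * g x, fun x => by have := hg0 x; positivity, ?_, fun s hs => ?_⟩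
  · rw [← Finset.mul_sum, div_mul_cancel₀ _ hpos.ne']
  · have h1 : ∑ x, s.indicator (fun x => c / (∑ x, g x) * g x) x =
        c / (∑ x, g x) * ∑ x, s.indicator g x := by
      rw [Finset.mul_sum]
      exact Finset.sum_congr rfl fun x _ => by by_cases h : x ∈ s <;> simp [h]
    rw [h1, div_mul_eq_mul_div, div_le_one hpos]
    have h2 : u < c⁻¹ * ∑ x, g x := huv.trans htot
    rw [inv_mul_eq_div, lt_div_iff₀ hc] at h2
    nlinarith [hind s hs]

/-! ### Ramsey's theorem and the upper bound for complete graphs -/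

/-- The Erdős–Szekeres form of Ramsey's theorem, with the bound `2 ^ (a + b)`. -/
theorem exists_isClique_or_isIndepSet_of_two_pow_le_card (G : SimpleGraph V) :
    ∀ (a b : ℕ) (A : Finset V), 2 ^ (a + b) ≤ A.card →
      (∃ S ⊆ A, S.card = a ∧ G.IsClique S) ∨ ∃ S ⊆ A, S.card = b ∧ G.IsIndepSet S := by
  classical
  intro a
  induction a with
  | zero => exact fun b A _ => Or.inl ⟨∅, by simp⟩
  | succ a iha =>
    intro b
    induction b with
    | zero => exact fun A _ => Or.inr ⟨∅, by simp [IsIndepSet]⟩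
    | succ b ihb =>
      intro A hA
      obtain ⟨v, hv⟩ : A.Nonempty := Finset.card_pos.1 (lt_of_lt_of_le (by positivity) hA)
      have hsplit := Finset.card_filter_add_card_filter_not (s := A.erase v) (G.Adj v)
      rw [Finset.card_erase_of_mem hv] at hsplit
      have hpow : 2 ^ (a + 1 + (b + 1)) = 2 ^ (a + (b + 1)) + 2 ^ (a + 1 + b) := by ring
      have hsub : ∀ (p : V → Prop) [DecidablePred p], (A.erase v).filter p ⊆ A := fun p _ =>
        (Finset.filter_subset _ _).trans (Finset.erase_subset _ _)
      have hins : ∀ (p : V → Prop) [DecidablePred p] (S : Finset V), S ⊆ (A.erase v).filter p →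
          insert v S ⊆ A ∧ (insert v S).card = S.card + 1 := fun p _ S hS =>
        ⟨Finset.insert_subset hv (hS.trans (hsub p)),
          Finset.card_insert_of_notMem fun h => by simpa using hS h⟩
      by_cases h : 2 ^ (a + (b + 1)) ≤ ((A.erase v).filter (G.Adj v)).card
      · rcases iha (b + 1) _ h with ⟨S, hS, hc, hcl⟩ | ⟨S, hS, hc, hcl⟩
        · refine Or.inl ⟨insert v S, (hins _ S hS).1, by rw [(hins _ S hS).2, hc], ?_⟩
          rw [Finset.coe_insert]
          exact hcl.insert fun u hu _ => (Finset.mem_filter.1 (hS hu)).2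
        · exact Or.inr ⟨S, hS.trans (hsub _), hc, hcl⟩
      · have h' : 2 ^ (a + 1 + b) ≤ ((A.erase v).filter fun u => ¬ G.Adj v u).card := by omega
        rcases ihb _ h' with ⟨S, hS, hc, hcl⟩ | ⟨S, hS, hc, hcl⟩
        · exact Or.inl ⟨S, hS.trans (hsub _), hc, hcl⟩
        · refine Or.inr ⟨insert v S, (hins _ S hS).1, by rw [(hins _ S hS).2, hc], ?_⟩
          rw [Finset.coe_insert, IsIndepSet]
          refine Set.Pairwise.insert hcl fun u hu _ => ?_
          have := (Finset.mem_filter.1 (hS hu)).2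
          exact ⟨this, fun h => this h.symm⟩

/-- Repeatedly removing a clique or an independent set of size `k` covers a set of vertices. -/
theorem exists_homogeneous_cover (G : SimpleGraph V) {k : ℕ} (hk : 0 < k) (A : Finset V) :
    ∃ P : Finset (Set V), (P.card : ℝ) ≤ A.card / k + 2 ^ (k + k) ∧
      (∀ s ∈ P, G.IsClique s ∨ G.IsIndepSet s) ∧ ∀ v ∈ A, ∃ s ∈ P, v ∈ s := by
  classical
  induction A using Finset.strongInduction with
  | H A ih =>
    by_cases hA : 2 ^ (k + k) ≤ A.card
    · obtain ⟨S, hSA, hc, hS⟩ : ∃ S ⊆ A, S.card = k ∧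
          (G.IsClique (S : Set V) ∨ G.IsIndepSet (S : Set V)) := by
        rcases G.exists_isClique_or_isIndepSet_of_two_pow_le_card k k A hA with
          ⟨S, h1, h2, h3⟩ | ⟨S, h1, h2, h3⟩
        exacts [⟨S, h1, h2, Or.inl h3⟩, ⟨S, h1, h2, Or.inr h3⟩]
      obtain ⟨P, hP, hhom, hcov⟩ := ih (A \ S) (Finset.sdiff_ssubset hSA
        (Finset.card_pos.1 (hc ▸ hk)))
      refine ⟨insert (S : Set V) P, ?_, ?_, fun v hv => ?_⟩
      · have h1 : ((insert (S : Set V) P).card : ℝ) ≤ P.card + 1 := by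
          exact_mod_cast Finset.card_insert_le _ _
        have h2 : ((A \ S).card : ℝ) = A.card - k := by
          rw [Finset.card_sdiff_of_subset hSA, Nat.cast_sub (Finset.card_le_card hSA), hc]
        have hk' : (k : ℝ) ≠ 0 := by positivity
        rw [h2, sub_div, div_self hk'] at hP
        linarith
      · simp only [Finset.mem_insert, forall_eq_or_imp]
        exact ⟨hS, hhom⟩
      · by_cases h : v ∈ S
        · exact ⟨S, Finset.mem_insert_self _ _, h⟩
        · obtain ⟨s, hs, hvs⟩ := hcov v (Finset.mem_sdiff.2 ⟨hv, h⟩)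
          exact ⟨s, Finset.mem_insert_of_mem hs, hvs⟩
    · refine ⟨A.image fun v => {v}, ?_, ?_, fun v hv => ⟨{v}, Finset.mem_image_of_mem _ hv, rfl⟩⟩
      · have h1 : (((A.image fun v => ({v} : Set V)).card : ℕ) : ℝ) ≤ 2 ^ (k + k) := by
          exact_mod_cast Finset.card_image_le.trans (not_le.1 hA).le
        have : (0 : ℝ) ≤ A.card / k := by positivity
        linarith
      · simp only [Finset.mem_image, forall_exists_index, and_imp, forall_apply_eq_imp_iff₂]
        exact fun v _ => Or.inl (by simp)

theorem fractionalCochromaticNumber_le_of_card_le [Fintype V] (G : SimpleGraph V) {n : ℕ}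
    (hn : 2 ≤ n) (hV : Fintype.card V ≤ n) :
    G.fractionalCochromaticNumber ≤ 10 * ((n : ℝ) / Real.logb 2 n) := by
  have hV' : (Fintype.card V : ℝ) ≤ n := by exact_mod_cast hV
  have hn' : (2 : ℝ) ≤ n := by exact_mod_cast hn
  have hl : 0 < Real.logb 2 n := Real.logb_pos one_lt_two (by linarith)
  set l := Real.logb 2 (n : ℝ) with hldef
  have hexp : (2 : ℝ) ^ l = n := Real.rpow_logb two_pos (by norm_num) (by linarith)
  by_cases h4 : 4 ≤ l
  -- The Ramsey leftover `2 ^ (k + k)` is then at most `√n ≤ 2 n / l`, while `k ≥ l / 8` gives `n /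
  -- k ≤ 8 n / l`; hence the constant 10.
  · set k := ⌊l / 4⌋₊ with hkdef
    have hk1 : 0 < k := Nat.floor_pos.2 (by linarith)
    have hk1' : (1 : ℝ) ≤ k := by exact_mod_cast hk1
    have hkle : (k : ℝ) ≤ l / 4 := Nat.floor_le (by linarith)
    have hklt : l / 4 < k + 1 := Nat.lt_floor_add_one _
    obtain ⟨P, hP, hhom, hcov⟩ := G.exists_homogeneous_cover hk1 Finset.univ
    refine (G.fractionalCochromaticNumber_le_card P hhom fun v => hcov v (by simp)).trans
      (hP.trans ?_)
    rw [Finset.card_univ]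
    have h1 : (Fintype.card V : ℝ) / k ≤ 8 * (n / l) := by
      rw [← mul_div_assoc, div_le_div_iff₀ (by linarith) hl]
      nlinarith
    have hhalf : (2 : ℝ) ^ (l / 2) * 2 ^ (l / 2) = n := by
      rw [← Real.rpow_add two_pos, add_halves, hexp]
    have h2 : (2 : ℝ) ^ (k + k) ≤ 2 ^ (l / 2) := by
      rw [← Real.rpow_natCast]
      refine Real.rpow_le_rpow_of_exponent_le one_le_two ?_
      push_cast
      linarith
    have h3 : l / 2 ≤ 2 ^ (l / 2) := by
      have := one_add_mul_self_le_rpow_one_add (s := 1) (p := l / 2) (by norm_num) (by linarith)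
      norm_num at this
      linarith
    have h5 : (2 : ℝ) ^ (l / 2) ≤ 2 * (n / l) := by
      rw [← mul_div_assoc, le_div_iff₀ hl, ← hhalf]
      have : (0 : ℝ) < 2 ^ (l / 2) := by positivity
      nlinarith
    linarith
  · push Not at h4
    obtain ⟨P, hcard, hP, hcov⟩ := exists_singletons_cover V
    refine (G.fractionalCochromaticNumber_le_card P
      (fun s hs => Or.inl ((hP s hs).pairwise _)) hcov).trans ?_
    have h1 : (P.card : ℝ) ≤ Fintype.card V := by exact_mod_cast hcard
    rw [← mul_div_assoc, le_div_iff₀ hl]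
    nlinarith

end SimpleGraph

/-! ### Union bound, layer-cake integrals and a geometric sum -/

/-- If the sets `T i` are large enough, some subset of `E` neither misses nor contains any of
them. -/
theorem Finset.exists_subset_not_disjoint_not_subset {α ι : Type*} (E : Finset α)
    (I : Finset ι) (T : ι → Finset α) (hT : ∀ i ∈ I, T i ⊆ E)
    (hsum : ∑ i ∈ I, 2 * ((2 : ℝ) ^ (T i).card)⁻¹ < 1) :
    ∃ ω ⊆ E, ∀ i ∈ I, ¬ Disjoint (T i) ω ∧ ¬ T i ⊆ ω := by
  classical
  by_contra! hcon
  -- Union bound by counting: each of the two bad events for `i` fixes `ω` on `T i`, leaving `2 ^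
  -- (|E| - |T i|)` choices.
  have hcover : E.powerset ⊆ I.biUnion fun i => (E \ T i).powerset ∪ Finset.Icc (T i) E := by
    intro ω hω
    rw [Finset.mem_powerset] at hω
    obtain ⟨i, hi, h⟩ := hcon ω hω
    refine Finset.mem_biUnion.2 ⟨i, hi, ?_⟩
    by_cases hd : Disjoint (T i) ω
    · exact Finset.mem_union_left _
        (Finset.mem_powerset.2 (Finset.subset_sdiff.2 ⟨hω, hd.symm⟩))
    · exact Finset.mem_union_right _ (Finset.mem_Icc.2 ⟨h hd, hω⟩)
  have hcard := (Finset.card_le_card hcover).trans Finset.card_biUnion_le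
  have hle : (2 : ℝ) ^ E.card ≤ ∑ i ∈ I, 2 ^ E.card * (2 * ((2 : ℝ) ^ (T i).card)⁻¹) := by
    rw [Finset.card_powerset] at hcard
    have : (2 : ℝ) ^ E.card ≤
        ∑ i ∈ I, (((E \ T i).powerset ∪ Finset.Icc (T i) E).card : ℝ) := by
      exact_mod_cast hcard
    refine this.trans (Finset.sum_le_sum fun i hi => ?_)
    have h1 := Finset.card_union_le (E \ T i).powerset (Finset.Icc (T i) E)
    rw [Finset.card_powerset, Finset.card_sdiff_of_subset (hT i hi),
      Finset.card_Icc_finset (hT i hi)] at h1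
    have h2 : (2 : ℝ) ^ (E.card - (T i).card) = 2 ^ E.card * ((2 : ℝ) ^ (T i).card)⁻¹ :=
      pow_sub₀ _ two_ne_zero (Finset.card_le_card (hT i hi))
    calc (((E \ T i).powerset ∪ Finset.Icc (T i) E).card : ℝ)
        ≤ 2 ^ (E.card - (T i).card) + 2 ^ (E.card - (T i).card) := by exact_mod_cast h1
      _ = _ := by rw [h2]; ring
  rw [← Finset.mul_sum] at hle
  have hpos : (0 : ℝ) < 2 ^ E.card := by positivity
  nlinarith

/-- The integral of a step function over the unit interval. -/
theorem integral_indicator_Iic_one {a : ℝ} (h0 : 0 ≤ a) (h1 : a ≤ 1) :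
    ∫ x in (0 : ℝ)..1, (if x ≤ a then (1 : ℝ) else 0) = a := by
  have := intervalIntegral.integral_indicator (μ := MeasureTheory.volume)
    (f := fun _ => (1 : ℝ)) (show a ∈ Set.Icc (0 : ℝ) 1 from ⟨h0, h1⟩)
  simpa [Set.indicator_apply] using this

theorem intervalIntegrable_indicator_Iic (a : ℝ) :
    IntervalIntegrable (fun x : ℝ => if x ≤ a then (1 : ℝ) else 0) MeasureTheory.volume 0 1 := by
  refine Antitone.intervalIntegrable fun x y hxy => ?_
  split_ifs <;> linarith

theorem integral_sum_indicator {ι : Type*} (s : Finset ι) (g : ι → ℝ)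
    (hg : ∀ i, 0 ≤ g i ∧ g i ≤ 1) :
    ∫ x in (0 : ℝ)..1, ∑ i ∈ s, (if x ≤ g i then (1 : ℝ) else 0) = ∑ i ∈ s, g i := by
  rw [intervalIntegral.integral_finsetSum fun i _ => intervalIntegrable_indicator_Iic (g i)]
  exact Finset.sum_congr rfl fun i _ => integral_indicator_Iic_one (hg i).1 (hg i).2

theorem intervalIntegrable_sum_indicator {ι : Type*} (s : Finset ι) (g : ι → ℝ) :
    IntervalIntegrable (fun x : ℝ => ∑ i ∈ s, if x ≤ g i then (1 : ℝ) else 0)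
      MeasureTheory.volume 0 1 := by
  have := IntervalIntegrable.sum (μ := MeasureTheory.volume) (a := 0) (b := 1) s
    (f := fun i (x : ℝ) => if x ≤ g i then (1 : ℝ) else 0)
    fun i _ => intervalIntegrable_indicator_Iic (g i)
  simpa only [Finset.sum_fn] using this

/-- The hypothesis says `q / (1 - q) ≤ m`, the sum of the full geometric series; the factor `1 - q ^
N` makes the induction close. -/
theorem sum_Icc_pow_le {q m : ℝ} (hq : 0 ≤ q) (hqm : q * (m + 1) ≤ m) (N : ℕ) :
    ∑ k ∈ Finset.Icc 1 N, q ^ k ≤ m * (1 - q ^ N) := by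
  induction N with
  | zero => simp
  | succ N ih =>
    rw [Finset.sum_Icc_succ_top (by omega), pow_succ]
    have := pow_nonneg hq N
    nlinarith

/-! ### The random subgraph -/

namespace SimpleGraph

variable {V : Type*}

open Classical in
/-- The edges of `G` inside `S`, as increasing pairs of vertices. -/
noncomputable def edgePairs [LinearOrder V] (G : SimpleGraph V) (S : Finset V) :
    Finset (V × V) :=
  (S ×ˢ S).filter fun p => p.1 < p.2 ∧ G.Adj p.1 p.2

theorem mem_edgePairs [LinearOrder V] {G : SimpleGraph V} {S : Finset V} {p : V × V} :
    p ∈ G.edgePairs S ↔ (p.1 ∈ S ∧ p.2 ∈ S) ∧ p.1 < p.2 ∧ G.Adj p.1 p.2 := by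
  simp [edgePairs]

/-- Initial segments have distinct positive sizes, so this is part of a geometric series, bounded
independently of the number of vertices. -/
theorem sum_pow_card_Iic_le [Fintype V] [LinearOrder V] {q m : ℝ} (hq : 0 ≤ q) (hm : 0 ≤ m)
    (hqm : q * (m + 1) ≤ m) :
    ∑ v : V, q ^ (Finset.univ.filter (· ≤ v)).card ≤ m := by
  have hinj : Function.Injective fun v : V => (Finset.univ.filter (· ≤ v)).card := by
    refine StrictMono.injective fun u v huv => Finset.card_lt_card ?_
    refine (Finset.ssubset_iff_of_subset fun w hw => ?_).2 ⟨v, by simp, by simpa using huv⟩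
    simp only [Finset.mem_filter, Finset.mem_univ, true_and] at hw ⊢
    exact hw.trans huv.le
  calc ∑ v : V, q ^ (Finset.univ.filter (· ≤ v)).card
      = ∑ k ∈ Finset.univ.image fun v : V => (Finset.univ.filter (· ≤ v)).card, q ^ k := by
        rw [Finset.sum_image fun u _ v _ h => hinj h]
    _ ≤ ∑ k ∈ Finset.Icc 1 (Fintype.card V), q ^ k := by
        refine Finset.sum_le_sum_of_subset_of_nonneg ?_ fun _ _ _ => pow_nonneg hq _
        intro k hk
        obtain ⟨v, -, rfl⟩ := Finset.mem_image.1 hk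
        exact Finset.mem_Icc.2 ⟨Finset.card_pos.2 ⟨v, by simp⟩, Finset.card_le_univ _⟩
    _ ≤ m * (1 - q ^ Fintype.card V) := sum_Icc_pow_le hq hqm _
    _ ≤ m := by
        have := pow_nonneg hq (Fintype.card V)
        nlinarith

/-- Some subgraph of `G` has no clique and no independent set spanning many edges of `G`. -/
theorem exists_le_card_edgePairs_le [Fintype V] [LinearOrder V] (G : SimpleGraph V) {m : ℝ}
    (hm : 1 < m) :
    ∃ H ≤ G, ∀ (v : V) (S : Finset V), (∀ u ∈ S, u ≤ v) → H.IsClique S ∨ H.IsIndepSet S →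
      ((G.edgePairs S).card : ℝ) ≤ S.card * Real.logb 2 m +
        4 / m * (Finset.univ.filter (· ≤ v)).card + Real.logb 2 m + 2 := by
  classical
  have hm0 : 0 < m := by linarith
  set L := Real.logb 2 m with hL
  let U : V → Finset V := fun v => Finset.univ.filter (· ≤ v)
  -- In `2 ^ (-thr)`, the term `|S| L` gives `m ^ (-|S|)`, which sums over `S ⊆ U v` to `(1 + 1/m) ^
  -- |U v| ≤ r ^ |U v|`. The term `4/m * |U v|` gives `r ^ (-2 |U v|)`: one half absorbs that sum,
  -- the other makes the sum over `v` at most `m`. The final `L + 2` contributes `1 / (4 m)`, so the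
  -- total failure bound is 1/2.
  let thr : V → Finset V → ℝ := fun v S => S.card * L + 4 / m * (U v).card + L + 2
  let I : Finset (Σ _ : V, Finset V) := Finset.univ.sigma fun v =>
    (U v).powerset.filter fun S => thr v S < (G.edgePairs S).card
  let r : ℝ := 2 ^ (2 / m)
  have hr0 : 0 < r := by positivity
  have hr : 1 + 1 / m ≤ r := by
    have h1 : (1 : ℝ) / m ≤ Real.log 2 * (2 / m) := by
      rw [mul_div_assoc', div_le_div_iff_of_pos_right hm0]
      have := Real.log_two_gt_d9
      linarith
    calc 1 + 1 / m ≤ Real.exp (1 / m) := by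
          have := Real.add_one_le_exp (1 / m)
          linarith
      _ ≤ Real.exp (Real.log 2 * (2 / m)) := Real.exp_le_exp.2 h1
      _ = r := (Real.rpow_def_of_pos two_pos _).symm
  have hthr : ∀ v S, (2 : ℝ) ^ thr v S = m ^ S.card * (r ^ (U v).card * r ^ (U v).card) *
      (m * 4) := by
    intro v S
    have h2L : (2 : ℝ) ^ L = m := Real.rpow_logb two_pos (by norm_num) hm0
    have hrU : r ^ (U v).card * r ^ (U v).card = 2 ^ (4 / m * (U v).card) := by
      rw [← mul_pow, ← Real.rpow_add two_pos, ← Real.rpow_natCast, ← Real.rpow_mul two_pos.le]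
      congr 1
      ring
    have hmS : m ^ S.card = (2 : ℝ) ^ (S.card * L) := by
      rw [mul_comm, Real.rpow_mul two_pos.le, h2L, Real.rpow_natCast]
    simp only [thr]
    rw [add_assoc, Real.rpow_add two_pos, Real.rpow_add two_pos, Real.rpow_add two_pos, h2L, hrU,
      hmS]
    norm_num
  have hinner : ∀ v, ∑ S ∈ (U v).powerset, 2 * ((2 : ℝ) ^ thr v S)⁻¹ ≤
      1 / (2 * m) * r⁻¹ ^ (U v).card := by
    intro v
    have hpow : ∑ S ∈ (U v).powerset, (1 / m) ^ S.card = (1 / m + 1) ^ (U v).card := by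
      simpa using Finset.sum_pow_mul_eq_add_pow (1 / m) 1 (U v)
    have hle : (1 / m + 1) ^ (U v).card ≤ r ^ (U v).card :=
      pow_le_pow_left₀ (by positivity) (by linarith) _
    calc ∑ S ∈ (U v).powerset, 2 * ((2 : ℝ) ^ thr v S)⁻¹
        = ∑ S ∈ (U v).powerset,
            1 / (2 * m) * (r⁻¹ ^ (U v).card * r⁻¹ ^ (U v).card) * (1 / m) ^ S.card := by
          refine Finset.sum_congr rfl fun S _ => ?_
          rw [hthr, inv_pow, one_div_pow]
          field_simp
          norm_num
      _ ≤ 1 / (2 * m) * (r⁻¹ ^ (U v).card * r⁻¹ ^ (U v).card) * r ^ (U v).card := by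
          rw [← Finset.mul_sum, hpow]
          exact mul_le_mul_of_nonneg_left hle (by positivity)
      _ = 1 / (2 * m) * r⁻¹ ^ (U v).card := by
          rw [inv_pow]
          field_simp
  have hq : r⁻¹ * (m + 1) ≤ m := by
    rw [inv_mul_le_iff₀ hr0]
    calc m + 1 = (1 + 1 / m) * m := by field_simp
      _ ≤ r * m := mul_le_mul_of_nonneg_right hr hm0.le
  have hsum : ∑ i ∈ I, 2 * ((2 : ℝ) ^ (G.edgePairs i.2).card)⁻¹ < 1 := by
    calc ∑ i ∈ I, 2 * ((2 : ℝ) ^ (G.edgePairs i.2).card)⁻¹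
        = ∑ v, ∑ S ∈ (U v).powerset.filter fun S => thr v S < (G.edgePairs S).card,
            2 * ((2 : ℝ) ^ (G.edgePairs S).card)⁻¹ := Finset.sum_sigma _ _ _
      _ ≤ ∑ v, ∑ S ∈ (U v).powerset, 2 * ((2 : ℝ) ^ thr v S)⁻¹ := by
          refine Finset.sum_le_sum fun v _ => ?_
          refine le_trans (Finset.sum_le_sum fun S hS => ?_)
            (Finset.sum_le_sum_of_subset_of_nonneg (Finset.filter_subset _ _)
              fun S _ _ => by positivity)
          have hlt := (Finset.mem_filter.1 hS).2
          refine mul_le_mul_of_nonneg_left (inv_anti₀ (by positivity) ?_) two_pos.le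
          rw [← Real.rpow_natCast]
          exact Real.rpow_le_rpow_of_exponent_le one_le_two hlt.le
      _ ≤ ∑ v, 1 / (2 * m) * r⁻¹ ^ (U v).card := Finset.sum_le_sum fun v _ => hinner v
      _ ≤ 1 / (2 * m) * m := by
          rw [← Finset.mul_sum]
          exact mul_le_mul_of_nonneg_left
            (sum_pow_card_Iic_le (inv_nonneg.2 hr0.le) hm0.le hq) (by positivity)
      _ < 1 := by
          rw [one_div, mul_inv, mul_assoc, inv_mul_cancel₀ hm0.ne']
          norm_num
  have hmono : ∀ S : Finset V, G.edgePairs S ⊆ G.edgePairs Finset.univ := fun S p hp => by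
    rw [mem_edgePairs] at hp ⊢
    exact ⟨by simp, hp.2⟩
  obtain ⟨ω, hωE, hω⟩ := Finset.exists_subset_not_disjoint_not_subset
    (G.edgePairs Finset.univ) I (fun i => G.edgePairs i.2) (fun i _ => hmono _) hsum
  have hadj : ∀ u v, (u, v) ∈ ω → u < v ∧ G.Adj u v := fun u v h =>
    (mem_edgePairs.1 (hωE h)).2
  refine ⟨SimpleGraph.fromRel fun u v => (u, v) ∈ ω, fun u v huv => ?_, fun v S hSv hS => ?_⟩
  · rcases huv.2 with h | h
    · exact (hadj _ _ h).2
    · exact (hadj _ _ h).2.symm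
  · by_contra! hlt
    obtain ⟨h1, h2⟩ := hω ⟨v, S⟩ (Finset.mem_sigma.2 ⟨Finset.mem_univ _, Finset.mem_filter.2
      ⟨Finset.mem_powerset.2 fun u hu => by simpa [U] using hSv u hu, hlt⟩⟩)
    rcases hS with hS | hS
    · refine h2 fun p hp => ?_
      obtain ⟨⟨hp1, hp2⟩, hpl, -⟩ := mem_edgePairs.1 hp
      rcases (hS hp1 hp2 hpl.ne).2 with h | h
      · exact h
      · exact absurd (hadj _ _ h).1 hpl.asymm
    · refine h1 (Finset.disjoint_left.2 fun p hp hpω => ?_)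
      obtain ⟨⟨hp1, hp2⟩, hpl, -⟩ := mem_edgePairs.1 hp
      exact hS hp1 hp2 hpl.ne ⟨hpl.ne, Or.inl hpω⟩

/-! ### Integration over level sets -/

/-- The bound on the number of edges, integrated over the upper level sets of a weight function
that decreases along the ordering. -/
theorem sum_edgePairs_le [Fintype V] [LinearOrder V] {G H : SimpleGraph V} {m L : ℝ}
    (hm : 0 < m) (hL : 0 ≤ L)
    (hH : ∀ (v : V) (S : Finset V), (∀ u ∈ S, u ≤ v) → H.IsClique S ∨ H.IsIndepSet S →
      ((G.edgePairs S).card : ℝ) ≤ S.card * L +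
        4 / m * (Finset.univ.filter (· ≤ v)).card + L + 2)
    {f : V → ℝ} (hf : Antitone f) (hf01 : ∀ v, 0 ≤ f v ∧ f v ≤ 1) (hfm : ∑ v, f v ≤ m)
    (S : Finset V) (hS : H.IsClique S ∨ H.IsIndepSet S) :
    ∑ p ∈ G.edgePairs S, f p.2 ≤ (∑ v ∈ S, f v) * L + L + 6 := by
  classical
  have hpt : ∀ x : ℝ, ∑ p ∈ G.edgePairs S, (if x ≤ f p.2 then (1 : ℝ) else 0) ≤
      (∑ v ∈ S, if x ≤ f v then (1 : ℝ) else 0) * L +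
        4 / m * (∑ v, if x ≤ f v then (1 : ℝ) else 0) + (L + 2) := by
    intro x
    simp only [Finset.sum_boole]
    have hsub : (S.filter fun v => x ≤ f v) ⊆ S := Finset.filter_subset _ _
    -- The later endpoint has the smaller weight, so an edge survives at level `x` exactly when both
    -- its endpoints do.
    have hpairs : (G.edgePairs S).filter (fun p => x ≤ f p.2) =
        G.edgePairs (S.filter fun v => x ≤ f v) := by
      ext p
      simp only [Finset.mem_filter, mem_edgePairs]
      exact ⟨fun ⟨⟨⟨h1, h2⟩, h3⟩, h4⟩ => ⟨⟨⟨h1, h4.trans (hf h3.1.le)⟩, h2, h4⟩, h3⟩,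
        fun ⟨⟨⟨h1, _⟩, h2, h4⟩, h3⟩ => ⟨⟨⟨h1, h2⟩, h3⟩, h4⟩⟩
    rw [hpairs]
    rcases (Finset.univ.filter fun v => x ≤ f v).eq_empty_or_nonempty with he | hne
    · have hSe : (S.filter fun v => x ≤ f v) = ∅ := Finset.subset_empty.1
        ((Finset.filter_subset_filter _ (Finset.subset_univ S)).trans_eq he)
      rw [he, hSe]
      simp only [edgePairs, Finset.product_empty, Finset.filter_empty, Finset.card_empty]
      norm_num
      linarith
    -- A nonempty level set is the initial segment ending at its last vertex `v`, and homogeneity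
    -- passes to subsets, so `hH` applies.
    · obtain ⟨v, hv, hmax⟩ := Finset.exists_max_image _ id hne
      have hU : (Finset.univ.filter fun u => x ≤ f u) = Finset.univ.filter (· ≤ v) := by
        ext u
        simp only [Finset.mem_filter, Finset.mem_univ, true_and] at hv hmax ⊢
        exact ⟨hmax u, fun h => hv.trans (hf h)⟩
      rw [hU, ← add_assoc]
      refine hH v _ (fun u hu => hmax u ?_) (hS.imp ?_ ?_)
      · simpa using (Finset.mem_filter.1 hu).2
      · exact fun h => h.subset (by exact_mod_cast hsub)
      · exact fun h => h.mono (by exact_mod_cast hsub)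
  have hint := intervalIntegral.integral_mono_on (μ := MeasureTheory.volume) (zero_le_one' ℝ)
    (intervalIntegrable_sum_indicator (G.edgePairs S) fun p => f p.2)
    ((((intervalIntegrable_sum_indicator S f).mul_const L).add
      ((intervalIntegrable_sum_indicator Finset.univ f).const_mul (4 / m))).add
        intervalIntegrable_const) fun x _ => hpt x
  rw [intervalIntegral.integral_add (((intervalIntegrable_sum_indicator S f).mul_const L).add
      ((intervalIntegrable_sum_indicator Finset.univ f).const_mul (4 / m)))
      intervalIntegrable_const,
    intervalIntegral.integral_add ((intervalIntegrable_sum_indicator S f).mul_const L)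
      ((intervalIntegrable_sum_indicator Finset.univ f).const_mul (4 / m)),
    intervalIntegral.integral_mul_const, intervalIntegral.integral_const_mul,
    integral_sum_indicator _ _ fun p => hf01 p.2, integral_sum_indicator _ _ hf01,
    integral_sum_indicator _ _ hf01] at hint
  simp only [intervalIntegral.integral_const, sub_zero, one_smul] at hint
  have h4 : 4 / m * ∑ v, f v ≤ 4 := by
    rw [div_mul_eq_mul_div, div_le_iff₀ hm]
    linarith
  linarith

/-! ### Lower bound on edge weight by greedy colouring -/

/-- Greedy colouring along a linear order. -/
theorem exists_coloring_of_card_back_lt [LinearOrder V] (G : SimpleGraph V) (D : ℕ)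
    (S : Finset V) [∀ v, DecidablePred fun u => u < v ∧ G.Adj u v]
    (hS : ∀ v ∈ S, (S.filter fun u => u < v ∧ G.Adj u v).card < D) :
    ∃ c : V → ℕ, (∀ v ∈ S, c v < D) ∧ ∀ u ∈ S, ∀ v ∈ S, G.Adj u v → c u ≠ c v := by
  classical
  induction S using Finset.induction_on_max with
  | empty => exact ⟨fun _ => 0, by simp⟩
  | insert a S hmax ih =>
    obtain ⟨c, hc, hproper⟩ := ih fun v hv => (Finset.card_le_card
      (Finset.filter_subset_filter _ (Finset.subset_insert a S))).trans_lt
        (hS v (Finset.mem_insert_of_mem hv))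
    have haS : a ∉ S := fun h => lt_irrefl a (hmax a h)
    have hlt : ((S.filter fun u => u < a ∧ G.Adj u a).image c).card < (Finset.range D).card := by
      rw [Finset.card_range]
      exact (Finset.card_image_le.trans (Finset.card_le_card
        (Finset.filter_subset_filter _ (Finset.subset_insert a S)))).trans_lt
          (hS a (Finset.mem_insert_self a S))
    obtain ⟨i, hi, hi'⟩ := Finset.exists_mem_notMem_of_card_lt_card hlt
    have hia : ∀ u ∈ S, G.Adj u a → c u ≠ i := fun u hu hadj h =>
      hi' (Finset.mem_image.2 ⟨u, Finset.mem_filter.2 ⟨hu, hmax u hu, hadj⟩, h⟩)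
    have hne : ∀ u ∈ S, u ≠ a := fun u hu h => haS (h ▸ hu)
    refine ⟨Function.update c a i, ?_, ?_⟩
    · intro v hv
      rcases Finset.mem_insert.1 hv with rfl | hv
      · simpa using hi
      · rw [Function.update_of_ne (hne v hv)]
        exact hc v hv
    · intro u hu v hv hadj
      rcases Finset.mem_insert.1 hu with rfl | hu' <;> rcases Finset.mem_insert.1 hv with rfl | hv'
      · exact absurd rfl hadj.ne
      · rw [Function.update_self, Function.update_of_ne (hne v hv')]
        exact (hia v hv' hadj.symm).symm
      · rw [Function.update_self, Function.update_of_ne (hne u hu')]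
        exact hia u hu' hadj
      · rw [Function.update_of_ne (hne v hv'), Function.update_of_ne (hne u hu')]
        exact hproper u hu' v hv' hadj

theorem sum_le_of_card_back_lt [LinearOrder V] {G : SimpleGraph V} {f : V → ℝ}
    (hind : ∀ I : Finset V, G.IsIndepSet I → ∑ v ∈ I, f v ≤ 1) (D : ℕ) (S : Finset V)
    [∀ v, DecidablePred fun u => u < v ∧ G.Adj u v]
    (hS : ∀ v ∈ S, (S.filter fun u => u < v ∧ G.Adj u v).card < D) : ∑ v ∈ S, f v ≤ D := by
  obtain ⟨c, hc, hproper⟩ := G.exists_coloring_of_card_back_lt D S hS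
  rw [← Finset.sum_fiberwise_of_maps_to (t := Finset.range D) (g := c)
    fun v hv => Finset.mem_range.2 (hc v hv)]
  refine (Finset.sum_le_card_nsmul _ _ 1 fun i _ => hind _ ?_).trans (by simp)
  intro u hu v hv _ hadj
  obtain ⟨hu1, hu2⟩ := Finset.mem_filter.1 (Finset.mem_coe.1 hu)
  obtain ⟨hv1, hv2⟩ := Finset.mem_filter.1 (Finset.mem_coe.1 hv)
  exact hproper u hu1 v hv1 hadj (hu2.trans hv2.symm)

/-- Vertices of `S` with fewer than `D` earlier neighbours in `S` are `D`-colourable, hence weigh at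
most `D` in total. Each remaining vertex is the later end of at least `D` edges. -/
theorem mul_sub_le_sum_edgePairs [LinearOrder V] {G : SimpleGraph V} {f : V → ℝ}
    (hf : ∀ v, 0 ≤ f v) (hind : ∀ I : Finset V, G.IsIndepSet I → ∑ v ∈ I, f v ≤ 1) (D : ℕ)
    (S : Finset V) : D * (∑ v ∈ S, f v - D) ≤ ∑ p ∈ G.edgePairs S, f p.2 := by
  classical
  let b : V → ℕ := fun v => (S.filter fun u => u < v ∧ G.Adj u v).card
  have hpairs : ∑ p ∈ G.edgePairs S, f p.2 = ∑ v ∈ S, b v * f v := by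
    rw [edgePairs, Finset.sum_filter, Finset.sum_product_right]
    refine Finset.sum_congr rfl fun v _ => ?_
    rw [← Finset.sum_filter]
    exact (Finset.sum_const (f v)).trans (nsmul_eq_mul _ _)
  have hlow : ∑ v ∈ S.filter (fun v => b v < D), f v ≤ D := by
    refine sum_le_of_card_back_lt hind D _ fun v hv => ?_
    exact (Finset.card_le_card (Finset.filter_subset_filter _ (Finset.filter_subset _ _))).trans_lt
      (Finset.mem_filter.1 hv).2
  have hsplit := Finset.sum_filter_add_sum_filter_not S (fun v => b v < D) f
  calc D * (∑ v ∈ S, f v - D) ≤ D * ∑ v ∈ S.filter (fun v => ¬ b v < D), f v :=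
        mul_le_mul_of_nonneg_left (by linarith) (Nat.cast_nonneg D)
    _ ≤ ∑ v ∈ S.filter (fun v => ¬ b v < D), b v * f v := by
        rw [Finset.mul_sum]
        refine Finset.sum_le_sum fun v hv => mul_le_mul_of_nonneg_right ?_ (hf v)
        exact_mod_cast not_lt.1 (Finset.mem_filter.1 hv).2
    _ ≤ ∑ p ∈ G.edgePairs S, f p.2 := by
        rw [hpairs]
        exact Finset.sum_le_sum_of_subset_of_nonneg (Finset.filter_subset _ _)
          fun v _ _ => mul_nonneg (Nat.cast_nonneg _) (hf v)

/-! ### Assembly of the lower bound -/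

theorem exists_linearOrder_antitone [Finite V] (f : V → ℝ) :
    ∃ _ : LinearOrder V, Antitone f := by
  have := Fintype.ofFinite V
  let φ : V → ℝᵒᵈ ×ₗ Fin (Fintype.card V) := fun v =>
    toLex (OrderDual.toDual (f v), Fintype.equivFin V v)
  have hφ : Function.Injective φ := fun u v h =>
    (Fintype.equivFin V).injective (congrArg Prod.snd (toLex.injective h))
  refine ⟨LinearOrder.lift' φ hφ, fun u v huv => ?_⟩
  have h : φ u ≤ φ v := huv
  rcases Prod.Lex.toLex_le_toLex.1 h with h | h
  · exact le_of_lt h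
  · exact (OrderDual.toDual.injective h.1).ge

/-- Some subgraph `H` of `G` has only cliques and independent sets of small weight. -/
theorem exists_le_sum_indicator_le [Fintype V] (G : SimpleGraph V) {m : ℝ} (hm : 1 < m)
    {f : V → ℝ} (hf : ∀ v, 0 ≤ f v) (hfm : ∑ v, f v ≤ m)
    (hind : ∀ s, G.IsIndepSet s → ∑ v, s.indicator f v ≤ 1) :
    ∃ H ≤ G, ∀ s, H.IsClique s ∨ H.IsIndepSet s →
      ∑ v, s.indicator f v ≤ 4 * Real.logb 2 m + 6 := by
  classical
  have hsum : ∀ S : Finset V, ∑ v, (S : Set V).indicator f v = ∑ v ∈ S, f v := fun S =>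
    Finset.sum_indicator_subset f (Finset.subset_univ S)
  have hind' : ∀ I : Finset V, G.IsIndepSet I → ∑ v ∈ I, f v ≤ 1 := fun I hI =>
    (hsum I).symm.trans_le (hind I hI)
  have hf01 : ∀ v, 0 ≤ f v ∧ f v ≤ 1 := fun v =>
    ⟨hf v, by simpa using hind' {v} (by simp [IsIndepSet])⟩
  have hL : 0 < Real.logb 2 m := Real.logb_pos one_lt_two hm
  obtain ⟨_, hanti⟩ := exists_linearOrder_antitone f
  obtain ⟨H, hHG, hH⟩ := G.exists_le_card_edgePairs_le hm
  refine ⟨H, hHG, fun s hs => ?_⟩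
  have hs' : ((s.toFinset : Finset V) : Set V) = s := Set.coe_toFinset s
  rw [← hs'] at hs ⊢
  rw [hsum]
  have h1 := sum_edgePairs_le (zero_lt_one.trans hm) hL.le hH hanti hf01 hfm _ hs
  set t := ∑ v ∈ s.toFinset, f v with ht
  have ht0 : 0 ≤ t := Finset.sum_nonneg fun v _ => hf v
  -- `D (t - D)` peaks at `D = t / 2`; rounding down costs at most 1, so `t² / 4 - 1 ≤ t L + L + 6`,
  -- which fails once `t > 4 L + 6`.
  have h2 := mul_sub_le_sum_edgePairs hf hind' ⌊t / 2⌋₊ s.toFinset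
  have hD1 : (⌊t / 2⌋₊ : ℝ) ≤ t / 2 := Nat.floor_le (by linarith)
  have hD2 : t / 2 < ⌊t / 2⌋₊ + 1 := Nat.lt_floor_add_one _
  rw [← ht] at h2
  set d : ℝ := (⌊t / 2⌋₊ : ℝ)
  set L := Real.logb 2 m
  by_contra! hcon
  have hsq : (t / 2 - d) ^ 2 ≤ 1 := by nlinarith
  nlinarith [mul_pos (sub_pos.2 hcon) (sub_pos.2 hcon)]

theorem exists_subgraph_le_fractionalCochromaticNumber [Finite V] (G : SimpleGraph V)
    (hG : 1 < G.fractionalChromaticNumber) :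
    ∃ H : G.Subgraph, (G.fractionalChromaticNumber - 1) /
      (4 * Real.logb 2 G.fractionalChromaticNumber + 6) ≤ H.coe.fractionalCochromaticNumber := by
  classical
  have := Fintype.ofFinite V
  set m := G.fractionalChromaticNumber
  have hL : 0 < Real.logb 2 m := Real.logb_pos one_lt_two hG
  set B := 4 * Real.logb 2 m + 6 with hB
  have hB0 : 0 < B := by linarith
  -- Duality is available only strictly below `m`; giving up 1 is harmless, as it only enters `ε`.
  obtain ⟨f, hf, hfc, hind⟩ := G.exists_weight_of_lt_fractionalChromaticNumber
    (c := m - 1) (by linarith) (by linarith)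
  obtain ⟨H, hHG, hH⟩ := G.exists_le_sum_indicator_le hG hf (by linarith) hind
  let K := SimpleGraph.toSubgraph H hHG
  let e : K.verts ≃ V := Equiv.Set.univ V
  refine ⟨K, ?_⟩
  have key := le_fractionalCochromaticNumber (G := K.coe) (g := fun v => f v / B)
    (fun v => div_nonneg (hf _) hB0.le) fun s hs => ?_
  · refine le_of_eq_of_le ?_ key
    rw [← hfc, Finset.sum_div]
    exact (e.sum_comp fun v => f v / B).symm
  · have h1 : ∑ v : K.verts, s.indicator (fun v => f v / B) v =
        (∑ v : V, (Subtype.val '' s).indicator f v) / B := by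
      rw [Finset.sum_div, ← e.sum_comp]
      refine Finset.sum_congr rfl fun v _ => ?_
      by_cases hv : v ∈ s
      · have : e v ∈ Subtype.val '' s := ⟨v, hv, rfl⟩
        rw [Set.indicator_of_mem hv, Set.indicator_of_mem this]
        rfl
      · have : e v ∉ Subtype.val '' s := by
          rintro ⟨w, hw, hwv⟩
          exact hv (Subtype.val_injective hwv ▸ hw)
        rw [Set.indicator_of_notMem hv, Set.indicator_of_notMem this, zero_div]
    rw [h1, div_le_one hB0]
    refine hH _ (hs.imp ?_ ?_)
    · rintro hs _ ⟨u, hu, rfl⟩ _ ⟨v, hv, rfl⟩ hne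
      exact hs hu hv fun h => hne (congrArg _ h)
    · rintro hs _ ⟨u, hu, rfl⟩ _ ⟨v, hv, rfl⟩ hne
      exact hs hu hv fun h => hne (congrArg _ h)

end SimpleGraph

/-! ### The error term and the conclusion -/

/-- The function is the `ε` for which `(1/4 - ε m) * (m / log₂ m)` equals the bound `(m - 1) / (4
log₂ m + 6)` exactly. -/
theorem tendsto_sub_one_div_logb :
    Tendsto (fun m : ℝ => 1 / 4 - (m - 1) / (4 * Real.logb 2 m + 6) * (Real.logb 2 m / m))
      atTop (𝓝 0) := by
  have hlog : Tendsto (fun m : ℝ => Real.logb 2 m) atTop atTop :=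
    Real.tendsto_logb_atTop one_lt_two
  have h1 : Tendsto (fun m : ℝ => 1 / 4 - (1 - m⁻¹) * (4 + 6 * (Real.logb 2 m)⁻¹)⁻¹) atTop
      (𝓝 (1 / 4 - (1 - 0) * (4 + 6 * 0)⁻¹)) :=
    tendsto_const_nhds.sub ((tendsto_const_nhds.sub tendsto_inv_atTop_zero).mul
      ((tendsto_const_nhds.add (tendsto_const_nhds.mul
        (tendsto_inv_atTop_zero.comp hlog))).inv₀ (by norm_num)))
  norm_num at h1
  refine h1.congr' ?_
  filter_upwards [eventually_gt_atTop 1] with m hm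
  have hL : 0 < Real.logb 2 m := Real.logb_pos one_lt_two hm
  have hm0 : 0 < m := by linarith
  field_simp

theorem theorem3p2 :
    (∃ ε : ℝ → ℝ, Tendsto ε atTop (𝓝 0) ∧
      ∀ (V : Type*) [Finite V] (G : SimpleGraph V) (m : ℝ),
        G.fractionalChromaticNumber = m → 1 < m →
          ∃ H : G.Subgraph,
            (1 / 4 - ε m) * (m / Real.logb 2 m) ≤ H.coe.fractionalCochromaticNumber) ∧
    (∀ n : ℕ, (⊤ : SimpleGraph (Fin n)).fractionalChromaticNumber = (n : ℝ)) ∧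
    (∃ C : ℝ, 0 < C ∧ ∀ n : ℕ, 2 ≤ n → ∀ H : (⊤ : SimpleGraph (Fin n)).Subgraph,
      H.coe.fractionalCochromaticNumber ≤ C * ((n : ℝ) / Real.logb 2 (n : ℝ))) := by
  classical
  refine ⟨⟨_, tendsto_sub_one_div_logb, fun V _ G m hG hm => ?_⟩,
    SimpleGraph.fractionalChromaticNumber_top, 10, by norm_num, fun n hn H => ?_⟩
  · subst hG
    obtain ⟨H, hH⟩ := G.exists_subgraph_le_fractionalCochromaticNumber hm
    refine ⟨H, le_of_eq_of_le ?_ hH⟩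
    have hL : 0 < Real.logb 2 G.fractionalChromaticNumber := Real.logb_pos one_lt_two hm
    have hm0 : 0 < G.fractionalChromaticNumber := by linarith
    rw [sub_sub_cancel]
    field_simp
  · exact H.coe.fractionalCochromaticNumber_le_of_card_le hn
      (by simpa using Fintype.card_subtype_le (· ∈ H.verts))
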